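/- An \emph{ordering} on a group $\Gamma$ is a left-invariant total order $\preceq$; its positive cone is $P_\preceq^+=\{g\in\Gamma : g\succ id\}$. The space $\mathcal{O}(\Gamma)$ of all orderings on $\Gamma$ has the topology with sub-basis the sets $\{\preceq \,:\, f\prec g\}$ ($f,g\in\Gamma$), and $\Gamma$ acts on it by conjugation: $g\preceq_f h$ if and only if $fgf^{-1}\preceq fhf^{-1}$. An ordering is \emph{Conradian} if for all $f\succ id$ and $g\succ id$ there is $n\in\mathbb{N}$ with $fg^n\succ g$. A subgroup $\Gamma_*$ is \emph{$\preceq$-convex} if $f\prec h\prec g$ with $f,g\in\Gamma_*$ and $h\in\Gamma$ implies $h\in\Gamma_*$. The \emph{Conradian soul} $\Gamma_\preceq^c$ is the largest $\preceq$-convex subgroup to which the restriction of $\preceq$ is Conradian. Let $\Gamma$ be a countable group and let $\preceq$ be an ordering on $\Gamma$ which is not Conradian, and whose Conradian soul $\Gamma_\preceq^c$ is non-trivial and admits only finitely many orderings $\preceq_1,\dots,\preceq_N$. For each $j\in\{1,\dots,N\}$ let $\preceq^j$ be the extension of $\preceq_j$ by $\preceq$, that is, the ordering on $\Gamma$ with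 positive cone $(P_\preceq^+\setminus\Gamma_\preceq^c)\cup P_{\preceq_j}^+$. Then there is at least one $j$ such that $\preceq^j$ is an accumulation point, in $\mathcal{O}(\Gamma)$, of its orbit $\{(\preceq^j)_f : f\in\Gamma\}$ under conjugation; that is, every neighbourhood of $\preceq^j$ contains a conjugate of $\preceq^j$ different from $\preceq^j$. -/

import Mathlib

open Topology Filter

/-- A left-invariant total order relation on the group `G`. -/
@[ext]
structure LeftOrdering (G : Type*) [Group G] where
  le : G → G → Prop
  refl : ∀ a, le a a
  trans : ∀ a b c, le a b → le b c → le a c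
  antisymm : ∀ a b, le a b → le b a → a = b
  total : ∀ a b, le a b ∨ le b a
  mul_left : ∀ f g h, le g h → le (f * g) (f * h)

namespace LeftOrdering

/-- The strict order `a ≺ b`. -/
def lt {G : Type*} [Group G] (O : LeftOrdering G) (a b : G) : Prop :=
  O.le a b ∧ a ≠ b

/-- The positive cone `{g | g ≻ id}`. -/
def posCone {G : Type*} [Group G] (O : LeftOrdering G) : Set G :=
  {g | O.lt 1 g}

/-- The topology on the space of all orderings of `G`: a sub-basis is formed by
the sets `U_{f,g}` of all the orderings for which `f ≺ g`. -/
instance instTopologicalSpace {G : Type*} [Group G] : TopologicalSpace (LeftOrdering G) :=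
  TopologicalSpace.generateFrom {U | ∃ f g : G, U = {O : LeftOrdering G | O.lt f g}}

/-- The image of an ordering under `f` for the action of `G` by conjugation:
`g ≼_f h` if and only if `f g f⁻¹ ≼ f h f⁻¹`. -/
def conj {G : Type*} [Group G] (O : LeftOrdering G) (f : G) : LeftOrdering G where
  le g h := O.le (f * g * f⁻¹) (f * h * f⁻¹)
  refl _ := O.refl _
  trans _ _ _ := O.trans _ _ _
  antisymm a b h₁ h₂ := by simpa using O.antisymm _ _ h₁ h₂
  total _ _ := O.total _ _
  mul_left k a b h := by
    have := O.mul_left (f * k * f⁻¹) _ _ h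
    simpa [mul_assoc] using this

/-- The set of all conjugates of an ordering. -/
def orbit {G : Type*} [Group G] (O : LeftOrdering G) : Set (LeftOrdering G) :=
  Set.range O.conj

/-- The restriction of an ordering to a subgroup. -/
def restrict {G : Type*} [Group G] (O : LeftOrdering G) (H : Subgroup G) : LeftOrdering H where
  le a b := O.le (a : G) (b : G)
  refl _ := O.refl _
  trans _ _ _ := O.trans _ _ _
  antisymm _ _ h₁ h₂ := Subtype.ext (O.antisymm _ _ h₁ h₂)
  total _ _ := O.total _ _
  mul_left _ _ _ h := O.mul_left _ _ _ h

/-- The Conrad property: for all positive `f, g` there is `n` such that `f gⁿ ≻ g`.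
(If `f ≻ g` then also `f g ≻ f ≻ g`, so that allowing `n = 0` makes no difference.) -/
def IsConradian {G : Type*} [Group G] (O : LeftOrdering G) : Prop :=
  ∀ f g : G, O.lt 1 f → O.lt 1 g → ∃ n : ℕ, O.lt g (f * g ^ n)

/-- Convexity of a subgroup with respect to an ordering. -/
def IsConvex {G : Type*} [Group G] (O : LeftOrdering G) (H : Subgroup G) : Prop :=
  ∀ f ∈ H, ∀ g ∈ H, ∀ h : G, O.lt f h → O.lt h g → h ∈ H

theorem IsConvex.mem_of_le {G : Type*} [Group G] {O : LeftOrdering G} {H : Subgroup G}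
    (hH : O.IsConvex H) {f g h : G} (hf : f ∈ H) (hg : g ∈ H) (h₁ : O.le f h) (h₂ : O.le h g) :
    h ∈ H := by
  by_cases e₁ : f = h
  · exact e₁ ▸ hf
  by_cases e₂ : h = g
  · exact e₂ ▸ hg
  exact hH f hf g hg h ⟨h₁, e₁⟩ ⟨h₂, e₂⟩

/-- Convex subgroups are linearly ordered by inclusion. -/
theorem IsConvex.le_total {G : Type*} [Group G] {O : LeftOrdering G} {H K : Subgroup G}
    (hH : O.IsConvex H) (hK : O.IsConvex K) : H ≤ K ∨ K ≤ H := by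
  have key : ∀ {A : Subgroup G} (x : G), x ∈ A → ∃ y ∈ A, O.le 1 y ∧ (y = x ∨ y = x⁻¹) := by
    intro A x hx
    rcases O.total 1 x with h | h
    · exact ⟨x, hx, h, Or.inl rfl⟩
    · refine ⟨x⁻¹, A.inv_mem hx, ?_, Or.inr rfl⟩
      simpa using O.mul_left x⁻¹ _ _ h
  by_contra hcon
  simp only [not_or, SetLike.not_le_iff_exists] at hcon
  obtain ⟨⟨h, hh, hhK⟩, ⟨k, hk, hkH⟩⟩ := hcon
  obtain ⟨h', hh', h1, eh⟩ := key h hh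
  obtain ⟨k', hk', k1, ek⟩ := key k hk
  have hh'K : h' ∉ K := by rcases eh with rfl | rfl <;> simpa using hhK
  have hk'H : k' ∉ H := by rcases ek with rfl | rfl <;> simpa using hkH
  rcases O.total h' k' with l | l
  · exact hh'K (hK.mem_of_le K.one_mem hk' h1 l)
  · exact hk'H (hH.mem_of_le H.one_mem hh' k1 l)

/-- The Conradian soul: the maximal subgroup that is both convex and Conradian
(see `isGreatest_conradianSoul`). -/
def conradianSoul {G : Type*} [Group G] (O : LeftOrdering G) : Subgroup G :=
  sSup {H : Subgroup G | O.IsConvex H ∧ (O.restrict H).IsConradian}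

theorem isGreatest_conradianSoul {G : Type*} [Group G] (O : LeftOrdering G) :
    IsGreatest {H : Subgroup G | O.IsConvex H ∧ (O.restrict H).IsConradian} O.conradianSoul := by
  set S : Set (Subgroup G) := {H | O.IsConvex H ∧ (O.restrict H).IsConradian} with hS
  refine ⟨?_, fun H hH => le_sSup hH⟩
  have hne : S.Nonempty := by
    refine ⟨⊥, ?_, ?_⟩
    · intro f hf g hg h h₁ h₂
      rw [Subgroup.mem_bot] at hf hg ⊢
      subst hf hg
      exact O.antisymm _ _ h₂.1 h₁.1
    · intro f g hf
      exact absurd (Subsingleton.elim _ _) hf.2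
  have hdir : DirectedOn (· ≤ ·) S := by
    intro A hA B hB
    rcases hA.1.le_total hB.1 with h | h
    · exact ⟨B, hB, h, le_rfl⟩
    · exact ⟨A, hA, le_rfl, h⟩
  have hmem : ∀ {x : G}, x ∈ O.conradianSoul ↔ ∃ H ∈ S, x ∈ H :=
    fun {x} => Subgroup.mem_sSup_of_directedOn hne hdir
  have hmem₂ : ∀ {x y : G}, x ∈ O.conradianSoul → y ∈ O.conradianSoul →
      ∃ H ∈ S, x ∈ H ∧ y ∈ H := by
    intro x y hx hy
    obtain ⟨A, hA, hxA⟩ := hmem.1 hx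
    obtain ⟨B, hB, hyB⟩ := hmem.1 hy
    obtain ⟨C, hC, hAC, hBC⟩ := hdir A hA B hB
    exact ⟨C, hC, hAC hxA, hBC hyB⟩
  constructor
  · intro f hf g hg h h₁ h₂
    obtain ⟨H, hH, hfH, hgH⟩ := hmem₂ hf hg
    exact hmem.2 ⟨H, hH, hH.1 f hfH g hgH h h₁ h₂⟩
  · rintro ⟨f, hf⟩ ⟨g, hg⟩ hf1 hg1
    obtain ⟨H, hH, hfH, hgH⟩ := hmem₂ hf hg
    obtain ⟨n, hn, hn'⟩ := hH.2 ⟨f, hfH⟩ ⟨g, hgH⟩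
      ⟨hf1.1, fun e => hf1.2 (Subtype.ext (Subtype.ext_iff.1 e :))⟩
      ⟨hg1.1, fun e => hg1.2 (Subtype.ext (Subtype.ext_iff.1 e :))⟩
    exact ⟨n, hn, fun e => hn' (Subtype.ext (Subtype.ext_iff.1 e :))⟩

theorem isConvex_conradianSoul {G : Type*} [Group G] (O : LeftOrdering G) :
    O.IsConvex O.conradianSoul :=
  (isGreatest_conradianSoul O).1.1

/-- If `x ≽ id` is outside a convex subgroup, then multiplying it on the left or on the right
by an element of the subgroup gives again an element `≽ id`. -/
theorem IsConvex.one_le_mul {G : Type*} [Group G] {O : LeftOrdering G} {H : Subgroup G}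
    (hH : O.IsConvex H) {x h : G} (hx : x ∉ H) (hh : h ∈ H) (h1 : O.le 1 x) :
    O.le 1 (h * x) ∧ O.le 1 (x * h) := by
  constructor
  · rcases O.total 1 (h * x) with l | l
    · exact l
    · have l' : O.le x h⁻¹ := by simpa using O.mul_left h⁻¹ _ _ l
      exact absurd (hH.mem_of_le H.one_mem (H.inv_mem hh) h1 l') hx
  · rcases O.total 1 (x * h) with l | l
    · exact l
    · have l' : O.le h x⁻¹ := by simpa using O.mul_left x⁻¹ _ _ l
      have l'' : O.le x⁻¹ 1 := by simpa using O.mul_left x⁻¹ _ _ h1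
      exact absurd (by simpa using H.inv_mem (hH.mem_of_le hh H.one_mem l' l'')) hx

/-- The extension by `O` of an ordering `P` of a convex subgroup `H`: its positive cone is
`(posCone O \ H) ∪ posCone P` (see `posCone_extend`). -/
def extend {G : Type*} [Group G] (O : LeftOrdering G) (H : Subgroup G) (hH : O.IsConvex H)
    (P : LeftOrdering H) : LeftOrdering G where
  le a b := (∃ h : a⁻¹ * b ∈ H, P.le 1 ⟨a⁻¹ * b, h⟩) ∨ (a⁻¹ * b ∉ H ∧ O.le 1 (a⁻¹ * b))
  refl a := Or.inl ⟨by simp, by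
    have : (⟨a⁻¹ * a, by simp⟩ : H) = 1 := Subtype.ext (by simp)
    rw [this]; exact P.refl 1⟩
  trans a b c := by
    have e : a⁻¹ * c = a⁻¹ * b * (b⁻¹ * c) := by group
    rw [e]
    generalize a⁻¹ * b = x
    generalize b⁻¹ * c = y
    rintro (⟨hx, px⟩ | ⟨hx, ox⟩) (⟨hy, py⟩ | ⟨hy, oy⟩)
    · refine Or.inl ⟨H.mul_mem hx hy, P.trans _ _ _ px ?_⟩
      simpa using P.mul_left ⟨x, hx⟩ _ _ py
    · exact Or.inr ⟨fun h => hy ((H.mul_mem_cancel_left hx).1 h), (hH.one_le_mul hy hx oy).1⟩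
    · exact Or.inr ⟨fun h => hx ((H.mul_mem_cancel_right hy).1 h), (hH.one_le_mul hx hy ox).2⟩
    · have hxy : O.le x (x * y) := by simpa using O.mul_left x _ _ oy
      exact Or.inr ⟨fun h => hx (hH.mem_of_le H.one_mem h ox hxy), O.trans _ _ _ ox hxy⟩
  antisymm a b := by
    have e : b⁻¹ * a = (a⁻¹ * b)⁻¹ := by group
    rw [e]
    intro h₁ h₂
    suffices h : a⁻¹ * b = 1 by exact inv_mul_eq_one.1 h
    revert h₁ h₂
    generalize a⁻¹ * b = x
    rintro (⟨hx, px⟩ | ⟨hx, ox⟩) (⟨hy, py⟩ | ⟨hy, oy⟩)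
    · have : P.le ⟨x, hx⟩ 1 := by
        have := P.mul_left ⟨x, hx⟩ _ _ py
        have e' : (⟨x, hx⟩ : H) * ⟨x⁻¹, hy⟩ = 1 := Subtype.ext (by simp)
        rwa [e', mul_one] at this
      exact congrArg Subtype.val (P.antisymm _ _ this px)
    · exact absurd (H.inv_mem hx) hy
    · exact absurd (by simpa using hy) hx
    · have : O.le x 1 := by simpa using O.mul_left x _ _ oy
      exact O.antisymm _ _ this ox
  total a b := by
    have e : b⁻¹ * a = (a⁻¹ * b)⁻¹ := by group
    rw [e]
    generalize a⁻¹ * b = x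
    by_cases hx : x ∈ H
    · rcases P.total 1 ⟨x, hx⟩ with l | l
      · exact Or.inl (Or.inl ⟨hx, l⟩)
      · refine Or.inr (Or.inl ⟨H.inv_mem hx, ?_⟩)
        have := P.mul_left ⟨x⁻¹, H.inv_mem hx⟩ _ _ l
        have e' : (⟨x⁻¹, H.inv_mem hx⟩ : H) * ⟨x, hx⟩ = 1 := Subtype.ext (by simp)
        rwa [e', mul_one] at this
    · rcases O.total 1 x with l | l
      · exact Or.inl (Or.inr ⟨hx, l⟩)
      · exact Or.inr (Or.inr ⟨by simpa using hx, by simpa using O.mul_left x⁻¹ _ _ l⟩)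
  mul_left f g h := by
    have e : (f * g)⁻¹ * (f * h) = g⁻¹ * h := by group
    rw [e]
    exact id

theorem posCone_extend {G : Type*} [Group G] (O : LeftOrdering G) (H : Subgroup G)
    (hH : O.IsConvex H) (P : LeftOrdering H) :
    (O.extend H hH P).posCone = (O.posCone \ H) ∪ (fun x : H => (x : G)) '' P.posCone := by
  ext x
  simp only [posCone, lt, extend, Set.mem_ofPred_eq, Set.mem_union, Set.mem_sdiff, Set.mem_image,
    SetLike.mem_coe, inv_one, one_mul]
  constructor
  · rintro ⟨⟨hx, px⟩ | ⟨hx, ox⟩, h1⟩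
    · exact Or.inr ⟨⟨x, hx⟩, ⟨px, fun e => h1 (congrArg Subtype.val e)⟩, rfl⟩
    · exact Or.inl ⟨⟨ox, h1⟩, hx⟩
  · rintro (⟨⟨ox, h1⟩, hx⟩ | ⟨⟨y, hy⟩, ⟨py, h1⟩, rfl⟩)
    · exact ⟨Or.inr ⟨hx, ox⟩, h1⟩
    · exact ⟨Or.inl ⟨hy, py⟩, fun e => h1 (Subtype.ext e)⟩

end LeftOrdering

/-!
Let `C` be the Conradian soul of `O` and, for an ordering `P` of `C`, let `E P` be the extension
of `P` by `O`. The conjugate of an ordering by `p⁻¹` declares `x` positive when `x p ≻ p`, that is,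
when `x` moves the point `p` of the ordered set `G` to the right. If `1 ≼ p ≼ ε` and `1 ≺ ε`, every `x ≽ ε`
is still positive for this conjugate, because `x p ≽ x ≽ ε ≽ p`, with a strict inequality unless
`p = 1`. So base points `p` slightly above `C` give conjugates of `E P` that agree with `O` on any
prescribed finite set of elements outside `C`. Since `C` has only finitely many orderings, one of
them, `P'`, serves all finite sets, and the orbit of `E P` accumulates at `E P'` provided that
these conjugates can be chosen different from every extension of an ordering of `C`
(`exists_accPt_orbit_extend`).

Suppose that this choice is impossible for some `ε`: for all `p` outside `C` with `1 ≼ p ≼ ε`, the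
conjugate by `p⁻¹` has the same positive elements outside `C` as `O`. Then `C` and `p C p⁻¹` are
both convex for the conjugate, hence comparable, and they are equal because a group with finitely
many orderings is not isomorphic to a proper convex subgroup (`IsConvex.eq_top_of_mulEquiv`). So
`p` normalizes the set `O.posOutside C` of positive elements outside `C`
(`IsConvex.mem_normalizer_posOutside`). The elements of the normalizer of `O.posOutside C` that lie
between powers of `ε` form a convex subgroup (`isConvex_normalizerHull`), on which `O` is Conradian,
since conjugation by its elements preserves positivity outside `C`
(`isConradian_restrict_of_le_normalizer`). This contradicts the maximality of `C`.

Finally, the relation "`E P'` is an accumulation point of the orbit of `E P`" is transitive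
(`accPt_orbit_trans`), and every `P` has such a `P'`. On a finite set, such a relation relates some
`P` to itself.
-/

namespace LeftOrdering

variable {G : Type*} [Group G]

/-! ### Positive cones -/

theorem lt_iff_inv_mul_mem_posCone {O : LeftOrdering G} {a b : G} :
    O.lt a b ↔ a⁻¹ * b ∈ O.posCone := by
  constructor
  · rintro ⟨h, hne⟩
    exact ⟨by simpa using O.mul_left a⁻¹ _ _ h, fun e => hne (inv_mul_eq_one.1 e.symm)⟩
  · rintro ⟨h, hne⟩
    exact ⟨by simpa using O.mul_left a _ _ h, fun e => hne (inv_mul_eq_one.2 e).symm⟩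

theorem mul_mem_posCone {O : LeftOrdering G} {x y : G} (hx : x ∈ O.posCone)
    (hy : y ∈ O.posCone) : x * y ∈ O.posCone := by
  have h : O.le x (x * y) := by simpa using O.mul_left x _ _ hy.1
  refine ⟨O.trans _ _ _ hx.1 h, fun e => hx.2 ?_⟩
  rw [← e] at h
  exact O.antisymm _ _ hx.1 h

theorem inv_notMem_posCone {O : LeftOrdering G} {x : G} (hx : x ∈ O.posCone) :
    x⁻¹ ∉ O.posCone := fun h => (mul_mem_posCone hx h).2 (by simp)

theorem mem_posCone_or_inv_mem {O : LeftOrdering G} {x : G} (hx : x ≠ 1) :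
    x ∈ O.posCone ∨ x⁻¹ ∈ O.posCone := by
  rcases O.total 1 x with h | h
  · exact Or.inl ⟨h, hx.symm⟩
  · exact Or.inr ⟨by simpa using O.mul_left x⁻¹ _ _ h, fun e => hx (inv_eq_one.1 e.symm)⟩

theorem mem_posCone_conj {O : LeftOrdering G} {p x : G} :
    x ∈ (O.conj p).posCone ↔ p * x * p⁻¹ ∈ O.posCone := by
  simp only [posCone, lt, conj, Set.mem_ofPred_eq, mul_one, mul_inv_cancel]
  refine and_congr_right fun _ => not_congr ?_
  rw [eq_comm, eq_comm (a := (1 : G)), conj_eq_one_iff]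

theorem mem_posCone_restrict {O : LeftOrdering G} {H : Subgroup G} {x : H} :
    x ∈ (O.restrict H).posCone ↔ (x : G) ∈ O.posCone := by
  simp [posCone, lt, restrict, Subtype.ext_iff]

/-- By totality, positive cones are pairwise incomparable, and they determine the ordering. -/
theorem eq_of_posCone_subset {A B : LeftOrdering G} (h : A.posCone ⊆ B.posCone) : A = B := by
  have key : ∀ x, x ∈ B.posCone → x ∈ A.posCone := fun x hx =>
    (mem_posCone_or_inv_mem hx.2.symm).resolve_right fun h' => inv_notMem_posCone hx (h h')
  ext a b
  have e : ∀ O : LeftOrdering G, O.le a b ↔ a = b ∨ O.lt a b := fun O =>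
    ⟨fun h => or_iff_not_imp_left.2 fun n => ⟨h, n⟩,
      fun h => h.elim (fun e => e ▸ O.refl a) And.left⟩
  rw [e, e, lt_iff_inv_mul_mem_posCone, lt_iff_inv_mul_mem_posCone]
  exact or_congr_right ⟨fun h' => h h', key _⟩

/-! ### Convex subgroups of groups with finitely many orderings -/

/-- The ordering pulled back along an injective homomorphism. -/
def comap {H : Type*} [Group H] (O : LeftOrdering G) (f : H →* G)
    (hf : Function.Injective f) : LeftOrdering H where
  le a b := O.le (f a) (f b)
  refl _ := O.refl _
  trans _ _ _ := O.trans _ _ _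
  antisymm _ _ h₁ h₂ := hf (O.antisymm _ _ h₁ h₂)
  total _ _ := O.total _ _
  mul_left k a b h := by simpa using O.mul_left (f k) _ _ h

theorem comap_injective {H : Type*} [Group H] (e : H ≃* G) :
    Function.Injective fun O : LeftOrdering G => O.comap e.toMonoidHom e.injective := by
  intro A B h
  ext a b
  have := congrArg (fun O : LeftOrdering H => O.le (e.symm a) (e.symm b)) h
  simpa [comap] using this

/-- The reversed ordering. -/
def reverse (O : LeftOrdering G) : LeftOrdering G where
  le a b := O.le b a
  refl _ := O.refl _
  trans _ _ _ h₁ h₂ := O.trans _ _ _ h₂ h₁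
  antisymm _ _ h₁ h₂ := O.antisymm _ _ h₂ h₁
  total _ _ := O.total _ _
  mul_left k _ _ h := O.mul_left k _ _ h

theorem lt_reverse {O : LeftOrdering G} {a b : G} : O.reverse.lt a b ↔ O.lt b a :=
  and_congr_right fun _ => ne_comm

theorem IsConvex.reverse {O : LeftOrdering G} {H : Subgroup G} (hH : O.IsConvex H) :
    O.reverse.IsConvex H := fun f hf g hg h h₁ h₂ =>
  hH g hg f hf h (lt_reverse.1 h₂) (lt_reverse.1 h₁)

theorem mem_posCone_extend_of_notMem {O : LeftOrdering G} {H : Subgroup G} {hH : O.IsConvex H}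
    {P : LeftOrdering H} {x : G} (hx : x ∉ H) :
    x ∈ (O.extend H hH P).posCone ↔ x ∈ O.posCone := by
  rw [posCone_extend]
  constructor
  · rintro (h | ⟨y, -, rfl⟩)
    exacts [h.1, absurd y.2 hx]
  · exact fun h => Or.inl ⟨h, hx⟩

theorem coe_mem_posCone_extend {O : LeftOrdering G} {H : Subgroup G} {hH : O.IsConvex H}
    {P : LeftOrdering H} {x : H} :
    (x : G) ∈ (O.extend H hH P).posCone ↔ x ∈ P.posCone := by
  rw [posCone_extend]
  constructor
  · rintro (h | ⟨y, hy, e⟩)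
    exacts [absurd x.2 h.2, Subtype.ext e ▸ hy]
  · exact fun h => Or.inr ⟨x, h, rfl⟩

theorem extend_injective {O : LeftOrdering G} {H : Subgroup G} (hH : O.IsConvex H) :
    Function.Injective (O.extend H hH) := by
  intro P Q h
  refine eq_of_posCone_subset fun x hx => ?_
  rw [← coe_mem_posCone_extend (hH := hH)] at hx ⊢
  rwa [← h]

/-- A group with finitely many orderings is not isomorphic to a proper convex subgroup: the
extensions of the orderings of a convex subgroup by `O` would exhaust all orderings, but the
extensions by the reverse of `O` are different. -/
theorem IsConvex.eq_top_of_mulEquiv [Finite (LeftOrdering G)] {O : LeftOrdering G}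
    {H : Subgroup G} (hH : O.IsConvex H) (e : H ≃* G) : H = ⊤ := by
  by_contra hne
  obtain ⟨x, -, hx⟩ := SetLike.exists_of_lt (lt_top_iff_ne_top.2 hne)
  have hsurj := Finite.surjective_of_injective
    ((extend_injective hH).comp (comap_injective e))
  obtain ⟨P, hP⟩ := hsurj (O.reverse.extend H hH.reverse (O.restrict H))
  have hiff : x ∈ O.posCone ↔ x ∈ O.reverse.posCone := by
    rw [← mem_posCone_extend_of_notMem (hH := hH) hx,
      ← mem_posCone_extend_of_notMem (hH := hH.reverse) (P := O.restrict H) hx, ← hP]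
    rfl
  have hrev : x ∈ O.reverse.posCone ↔ x⁻¹ ∈ O.posCone := by
    rw [posCone, Set.mem_ofPred_eq, lt_reverse, lt_iff_inv_mul_mem_posCone, mul_one]
  rw [hrev] at hiff
  rcases mem_posCone_or_inv_mem (O := O) (x := x) (fun h => hx (h ▸ H.one_mem)) with h | h
  · exact inv_notMem_posCone h (hiff.1 h)
  · exact inv_notMem_posCone (hiff.2 h) h

theorem IsConvex.restrict_subgroupOf {O : LeftOrdering G} {D C : Subgroup G}
    (hD : O.IsConvex D) : (O.restrict C).IsConvex (D.subgroupOf C) := by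
  intro f hf g hg h h₁ h₂
  exact hD f hf g hg h ⟨h₁.1, fun e => h₁.2 (Subtype.ext e)⟩ ⟨h₂.1, fun e => h₂.2 (Subtype.ext e)⟩

theorem IsConvex.eq_of_le_of_mulEquiv {O : LeftOrdering G} {D C : Subgroup G}
    [Finite (LeftOrdering C)] (hD : O.IsConvex D) (hle : D ≤ C) (e : D ≃* C) : D = C :=
  le_antisymm hle <| Subgroup.subgroupOf_eq_top.1 <|
    hD.restrict_subgroupOf.eq_top_of_mulEquiv ((Subgroup.subgroupOfEquivOfLe hle).trans e)

/-- Isomorphic convex subgroups with finitely many orderings coincide. -/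
theorem IsConvex.eq_of_mulEquiv {O : LeftOrdering G} {D C : Subgroup G}
    [Finite (LeftOrdering C)] (hC : O.IsConvex C) (hD : O.IsConvex D) (e : D ≃* C) : D = C := by
  rcases hC.le_total hD with h | h
  · have : Finite (LeftOrdering D) := Finite.of_injective _ (comap_injective e.symm)
    exact (hC.eq_of_le_of_mulEquiv h e.symm).symm
  · exact hD.eq_of_le_of_mulEquiv h e

theorem IsConvex.map_conj {O : LeftOrdering G} {C : Subgroup G} (hC : O.IsConvex C) (p : G) :
    (O.conj p⁻¹).IsConvex (C.map (MulAut.conj p).toMonoidHom) := by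
  rintro _ ⟨f, hf, rfl⟩ _ ⟨g, hg, rfl⟩ h h₁ h₂
  refine ⟨p⁻¹ * h * p, hC f hf g hg _ ?_ ?_, by simp [mul_assoc]⟩
  · rw [lt_iff_inv_mul_mem_posCone, mem_posCone_conj] at h₁
    rw [lt_iff_inv_mul_mem_posCone]
    simpa [mul_assoc] using h₁
  · rw [lt_iff_inv_mul_mem_posCone, mem_posCone_conj] at h₂
    rw [lt_iff_inv_mul_mem_posCone]
    simpa [mul_assoc] using h₂

/-! ### Positive elements outside a convex subgroup -/

/-- The positive elements outside the subgroup `H`. For convex `H` these are the elements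
that move the coset `H` to the right. -/
def posOutside (O : LeftOrdering G) (H : Subgroup G) : Set G :=
  O.posCone \ H

section

variable {O : LeftOrdering G} {H : Subgroup G}

theorem mem_posOutside_or {x : G} (hx : x ∉ H) :
    x ∈ O.posOutside H ∨ x⁻¹ ∈ O.posOutside H :=
  (mem_posCone_or_inv_mem (ne_of_mem_of_not_mem H.one_mem hx).symm).imp (⟨·, hx⟩)
    (⟨·, fun h => hx (H.inv_mem_iff.1 h)⟩)

theorem inv_notMem_posOutside {x : G} (hx : x ∈ O.posOutside H) : x⁻¹ ∉ O.posOutside H :=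
  fun h => inv_notMem_posCone hx.1 h.1

theorem IsConvex.mul_mem_posOutside_of_mem_left (hH : O.IsConvex H) {h x : G} (hh : h ∈ H)
    (hx : x ∈ O.posOutside H) : h * x ∈ O.posOutside H := by
  have hn : h * x ∉ H := fun h' => hx.2 ((H.mul_mem_cancel_left hh).1 h')
  exact ⟨⟨(hH.one_le_mul hx.2 hh hx.1.1).1, fun e => hn (e ▸ H.one_mem)⟩, hn⟩

theorem IsConvex.mul_mem_posOutside_of_mem_right (hH : O.IsConvex H) {h x : G} (hh : h ∈ H)
    (hx : x ∈ O.posOutside H) : x * h ∈ O.posOutside H := by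
  have hn : x * h ∉ H := fun h' => hx.2 ((H.mul_mem_cancel_right hh).1 h')
  exact ⟨⟨(hH.one_le_mul hx.2 hh hx.1.1).2, fun e => hn (e ▸ H.one_mem)⟩, hn⟩

theorem IsConvex.mul_mem_posOutside (hH : O.IsConvex H) {x y : G} (hx : x ∈ O.posOutside H)
    (hy : y ∈ O.posOutside H) : x * y ∈ O.posOutside H := by
  refine ⟨mul_mem_posCone hx.1 hy.1, fun h => hx.2 (hH.mem_of_le H.one_mem h hx.1.1 ?_)⟩
  simpa using O.mul_left x _ _ hy.1.1

/-- The hypothesis `x⁻¹ ∉ O.posOutside H` says that `x` does not move the coset `H` to the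
left. -/
theorem IsConvex.mul_mem_posOutside_left (hH : O.IsConvex H) {x y : G}
    (hx : x⁻¹ ∉ O.posOutside H) (hy : y ∈ O.posOutside H) : x * y ∈ O.posOutside H := by
  by_cases h : x ∈ H
  · exact hH.mul_mem_posOutside_of_mem_left h hy
  · exact hH.mul_mem_posOutside ((mem_posOutside_or h).resolve_right hx) hy

theorem IsConvex.mul_mem_posOutside_right (hH : O.IsConvex H) {x y : G}
    (hx : x ∈ O.posOutside H) (hy : y⁻¹ ∉ O.posOutside H) : x * y ∈ O.posOutside H := by
  by_cases h : y ∈ H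
  · exact hH.mul_mem_posOutside_of_mem_right h hx
  · exact hH.mul_mem_posOutside hx ((mem_posOutside_or h).resolve_right hy)

theorem IsConvex.le_normalizer_posOutside (hH : O.IsConvex H) :
    H ≤ Subgroup.normalizer (O.posOutside H) :=
  Subgroup.le_set_normalizer_iff.2 fun _ hh _ hx =>
    hH.mul_mem_posOutside_of_mem_right (H.inv_mem hh) (hH.mul_mem_posOutside_of_mem_left hh hx)

theorem posOutside_extend {hH : O.IsConvex H} {P : LeftOrdering H} :
    (O.extend H hH P).posOutside H = O.posOutside H := by
  ext x
  exact and_congr_left fun h => mem_posCone_extend_of_notMem h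

/-- Convexity of `H` depends only on the positive elements outside `H`. -/
theorem IsConvex.of_posOutside_eq {A : LeftOrdering G} (hH : O.IsConvex H)
    (h : A.posOutside H = O.posOutside H) : A.IsConvex H := by
  intro f hf g hg k h₁ h₂
  by_contra hk
  rw [lt_iff_inv_mul_mem_posCone] at h₁ h₂
  have h₁' : f⁻¹ * k ∈ O.posOutside H :=
    h ▸ ⟨h₁, fun h' => hk ((H.mul_mem_cancel_left (H.inv_mem hf)).1 h')⟩
  have h₂' : k⁻¹ * g ∈ O.posOutside H :=
    h ▸ ⟨h₂, fun h' => hk (H.inv_mem_iff.1 ((H.mul_mem_cancel_right hg).1 h'))⟩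
  refine (hH.mul_mem_posOutside h₁' h₂').2 ?_
  simpa [mul_assoc] using H.mul_mem (H.inv_mem hf) hg

/-- If the conjugate by `p⁻¹` has the same positive elements outside `H`, then `H` and
`p H p⁻¹` are isomorphic convex subgroups for it, so that `p` normalizes `H`. -/
theorem IsConvex.mem_normalizer_posOutside [Finite (LeftOrdering H)] (hH : O.IsConvex H) {p : G}
    (h : (O.conj p⁻¹).posOutside H = O.posOutside H) :
    p ∈ Subgroup.normalizer (O.posOutside H) := by
  have hmap : H.map (MulAut.conj p).toMonoidHom = H :=
    (hH.of_posOutside_eq h).eq_of_mulEquiv (hH.map_conj p)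
      (H.equivMapOfInjective _ (MulAut.conj p).injective).symm
  have hp : p ∈ Subgroup.normalizer (H : Set G) := Subgroup.mem_normalizer_iff_map_conj_eq.2 hmap
  refine Subgroup.mem_set_normalizer_iff.2 fun x => ?_
  have hx : p * x * p⁻¹ ∈ O.posOutside H ↔ p * x * p⁻¹ ∈ (O.conj p⁻¹).posOutside H := by rw [h]
  rw [hx, posOutside, posOutside, Set.mem_sdiff, Set.mem_sdiff, mem_posCone_conj,
    ← Subgroup.mem_set_normalizer_iff.1 hp x]
  simp [mul_assoc]

end

/-! ### A Conradian subgroup above a convex subgroup -/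

section

variable {O : LeftOrdering G} {C : Subgroup G}

/-- The elements `h` that normalize the set of positive elements outside `C` and whose coset
`h C` lies strictly between `ε⁻ⁿ C` and `εⁿ C` for some `n`. As `h` is a normalizer,
`h C < εⁿ C` is equivalent to `εⁿ h⁻¹` being a positive element outside `C`. -/
def normalizerHull (hC : O.IsConvex C) {ε : G} (hε : ε ∈ O.posOutside C)
    (hεS : ε ∈ Subgroup.normalizer (O.posOutside C)) : Subgroup G where
  carrier := {h | h ∈ Subgroup.normalizer (O.posOutside C) ∧
    ∃ n : ℕ, ε ^ n * h ∈ O.posOutside C ∧ ε ^ n * h⁻¹ ∈ O.posOutside C}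
  one_mem' := ⟨one_mem _, 1, by simpa using hε, by simpa using hε⟩
  inv_mem' := by
    rintro h ⟨hS, n, h₁, h₂⟩
    exact ⟨inv_mem hS, n, h₂, by simpa using h₁⟩
  mul_mem' := by
    have key : ∀ {a b : G} {i j : ℕ}, ε ^ i * a ∈ O.posOutside C → ε ^ j * b ∈ O.posOutside C →
        ε ^ (i + j) * (a * b) ∈ O.posOutside C := by
      intro a b i j ha hb
      have := hC.mul_mem_posOutside
        ((Subgroup.mem_set_normalizer_iff.1 (pow_mem hεS j) _).1 ha) hb
      convert! this using 1
      rw [add_comm, pow_add]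
      group
    rintro h k ⟨hS, n, h₁, h₂⟩ ⟨kS, m, k₁, k₂⟩
    refine ⟨mul_mem hS kS, n + m, key h₁ k₁, ?_⟩
    rw [mul_inv_rev, add_comm]
    exact key k₂ h₂

theorem mem_normalizerHull_self (hC : O.IsConvex C) {ε : G} (hε : ε ∈ O.posOutside C)
    (hεS : ε ∈ Subgroup.normalizer (O.posOutside C)) : ε ∈ normalizerHull hC hε hεS :=
  ⟨hεS, 2, by simpa [pow_two] using hC.mul_mem_posOutside (hC.mul_mem_posOutside hε hε) hε,
    by simpa [pow_two] using hε⟩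

/-- If all elements between `1` and `ε` normalize a set of the form `O.posOutside C`, then so do
all elements between `1` and a power of `ε`. -/
theorem IsConvex.mem_normalizer_of_lt_pow (hC : O.IsConvex C) {ε : G}
    (hεS : ε ∈ Subgroup.normalizer (O.posOutside C))
    (hint : ∀ p, p ∈ O.posOutside C → p⁻¹ * ε ∈ O.posOutside C →
      p ∈ Subgroup.normalizer (O.posOutside C)) (n : ℕ) {p : G}
    (hp : p⁻¹ ∉ O.posOutside C) (hp' : (p⁻¹ * ε ^ n)⁻¹ ∉ O.posOutside C) :
    p ∈ Subgroup.normalizer (O.posOutside C) := by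
  induction n with
  | zero =>
    by_contra h
    have hpC : p ∉ C := fun h' => h (hC.le_normalizer_posOutside h')
    rcases mem_posOutside_or (O := O) hpC with h' | h'
    · exact hp' (by simpa using h')
    · exact hp h'
  | succ n ih =>
    by_cases hy : (p⁻¹ * ε ^ n)⁻¹ ∈ O.posOutside C
    · rw [mul_inv_rev, inv_inv] at hy
      rw [← mul_inv_cancel_left (ε ^ n) p]
      refine mul_mem (pow_mem hεS n) ?_
      have e : p⁻¹ * ε ^ (n + 1) = ((ε ^ n)⁻¹ * p)⁻¹ * ε := by rw [pow_succ]; group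
      rw [e] at hp'
      generalize (ε ^ n)⁻¹ * p = y at hy hp'
      by_cases hyC : y⁻¹ * ε ∈ C
      · have hy' : y = ε * (y⁻¹ * ε)⁻¹ := by group
        rw [hy']
        exact mul_mem hεS (inv_mem (hC.le_normalizer_posOutside hyC))
      · exact hint y hy ((mem_posOutside_or hyC).resolve_right hp')
    · exact ih hy

theorem isConvex_normalizerHull (hC : O.IsConvex C) {ε : G} (hε : ε ∈ O.posOutside C)
    (hεS : ε ∈ Subgroup.normalizer (O.posOutside C))
    (hint : ∀ p, p ∈ O.posOutside C → p⁻¹ * ε ∈ O.posOutside C →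
      p ∈ Subgroup.normalizer (O.posOutside C)) :
    O.IsConvex (normalizerHull hC hε hεS) := by
  rintro f ⟨hfS, n, hf, -⟩ g ⟨hgS, m, -, hg⟩ h h₁ h₂
  rw [lt_iff_inv_mul_mem_posCone] at h₁ h₂
  replace h₁ : (f⁻¹ * h)⁻¹ ∉ O.posOutside C := fun h' => inv_notMem_posCone h₁ h'.1
  replace h₂ : (h⁻¹ * g)⁻¹ ∉ O.posOutside C := fun h' => inv_notMem_posCone h₂ h'.1
  -- `h C` lies strictly between `ε⁻ⁿ C` and `εᵐ C`
  have hl : ε ^ n * h ∈ O.posOutside C := by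
    simpa [mul_assoc] using hC.mul_mem_posOutside_right hf h₁
  have hg' : g⁻¹ * ε ^ m ∈ O.posOutside C := by
    have := (Subgroup.mem_set_normalizer_iff.1 (inv_mem hgS) _).1 hg
    simpa [mul_assoc] using this
  have hr : h⁻¹ * ε ^ m ∈ O.posOutside C := by
    simpa [mul_assoc] using hC.mul_mem_posOutside_left h₂ hg'
  have hS : h ∈ Subgroup.normalizer (O.posOutside C) := by
    rw [← inv_mul_cancel_left (ε ^ n) h]
    refine mul_mem (inv_mem (pow_mem hεS n)) (hC.mem_normalizer_of_lt_pow hεS hint (n + m)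
      (inv_notMem_posOutside hl) ?_)
    have e : (ε ^ n * h)⁻¹ * ε ^ (n + m) = h⁻¹ * ε ^ m := by rw [pow_add]; group
    rw [e]
    exact inv_notMem_posOutside hr
  have hr' : ε ^ m * h⁻¹ ∈ O.posOutside C := by
    have := (Subgroup.mem_set_normalizer_iff.1 hS _).1 hr
    simpa [mul_assoc] using this
  have hpow : ∀ i j : ℕ, ∀ x : G, ε ^ j * x ∈ O.posOutside C →
      ε ^ (i + j) * x ∈ O.posOutside C := by
    intro i j x hx
    induction i with
    | zero => simpa using hx
    | succ i ih =>
      have := hC.mul_mem_posOutside hε ih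
      rwa [← mul_assoc, ← pow_succ', add_right_comm] at this
  exact ⟨hS, m + n, hpow m n h hl, add_comm n m ▸ hpow n m h⁻¹ hr'⟩

/-- An ordering whose restriction to a convex subgroup `C` is Conradian is Conradian on every
subgroup that normalizes the set of positive elements outside `C`. -/
theorem isConradian_restrict_of_le_normalizer (hC : O.IsConvex C)
    (hcon : (O.restrict C).IsConradian) {H : Subgroup G}
    (hH : H ≤ Subgroup.normalizer (O.posOutside C)) : (O.restrict H).IsConradian := by
  rintro ⟨f, hf⟩ ⟨g, hg⟩ hf1 hg1
  have hf' : f ∈ O.posCone := mem_posCone_restrict.1 hf1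
  have hg' : g ∈ O.posCone := mem_posCone_restrict.1 hg1
  suffices h : ∃ n : ℕ, g⁻¹ * (f * g ^ n) ∈ O.posCone by
    obtain ⟨n, hn⟩ := h
    exact ⟨n, lt_iff_inv_mul_mem_posCone.2 (mem_posCone_restrict.2 (by simpa using hn))⟩
  by_cases hfC : f ∈ C
  · by_cases hgC : g ∈ C
    · obtain ⟨n, hn⟩ := hcon ⟨f, hfC⟩ ⟨g, hgC⟩ (mem_posCone_restrict.2 hf')
        (mem_posCone_restrict.2 hg')
      refine ⟨n, ?_⟩
      simpa using mem_posCone_restrict.1 (lt_iff_inv_mul_mem_posCone.1 hn)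
    · refine ⟨2, ?_⟩
      have := (Subgroup.mem_set_normalizer_iff.1 (inv_mem (hH hg)) _).1
        (hC.mul_mem_posOutside_of_mem_left hfC ⟨hg', hgC⟩)
      simpa [mul_assoc, pow_two] using this.1
  · refine ⟨1, ?_⟩
    have := (Subgroup.mem_set_normalizer_iff.1 (inv_mem (hH hg)) _).1 ⟨hf', hfC⟩
    simpa [mul_assoc] using this.1

/-- Arbitrarily close to the Conradian soul `C` from above there are elements `p` that do not
normalize the set of positive elements outside `C`: otherwise they would generate, together
with `C`, a larger convex subgroup on which the ordering is Conradian. -/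
theorem exists_notMem_normalizer_conradianSoul {ε : G} (hε : ε ∈ O.posOutside O.conradianSoul) :
    ∃ p, p ∈ O.posOutside O.conradianSoul ∧ (p = ε ∨ p⁻¹ * ε ∈ O.posOutside O.conradianSoul) ∧
      p ∉ Subgroup.normalizer (O.posOutside O.conradianSoul) := by
  by_contra! hcon
  have hC := O.isConvex_conradianSoul
  have hεS := hcon ε hε (Or.inl rfl)
  have hle : normalizerHull hC hε hεS ≤ O.conradianSoul := O.isGreatest_conradianSoul.2
    ⟨isConvex_normalizerHull hC hε hεS fun p hp hp' => hcon p hp (Or.inr hp'),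
      isConradian_restrict_of_le_normalizer hC O.isGreatest_conradianSoul.1.2 fun _ h => h.1⟩
  exact hε.2 (hle (mem_normalizerHull_self hC hε hεS))

theorem posOutside_conradianSoul_nonempty (hO : ¬ O.IsConradian) :
    (O.posOutside O.conradianSoul).Nonempty := by
  by_contra hne
  have htop : ∀ x, x ∈ O.conradianSoul := fun x => by
    by_contra hx
    rcases mem_posOutside_or (O := O) hx with h | h
    exacts [hne ⟨_, h⟩, hne ⟨_, h⟩]
  refine hO fun f g hf hg => ?_
  obtain ⟨n, hn⟩ := O.isGreatest_conradianSoul.1.2 ⟨f, htop f⟩ ⟨g, htop g⟩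
    (mem_posCone_restrict.2 hf) (mem_posCone_restrict.2 hg)
  exact ⟨n, lt_iff_inv_mul_mem_posCone.2
    (by simpa using mem_posCone_restrict.1 (lt_iff_inv_mul_mem_posCone.1 hn))⟩

end

/-! ### Accumulation points of orbits -/

theorem isOpen_setOf_lt (f g : G) : IsOpen {O : LeftOrdering G | O.lt f g} :=
  TopologicalSpace.isOpen_generateFrom_of_mem ⟨f, g, rfl⟩

/-- Every neighbourhood of an ordering contains all the orderings for which some finite set of
its positive elements is positive. -/
theorem exists_finset_of_mem_nhds {A : LeftOrdering G} {U : Set (LeftOrdering G)} (hU : U ∈ 𝓝 A) :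
    ∃ F : Set G, F.Finite ∧ F ⊆ A.posCone ∧ ∀ B : LeftOrdering G, F ⊆ B.posCone → B ∈ U := by
  obtain ⟨V, hVU, hV, hAV⟩ := mem_nhds_iff.1 hU
  suffices h : ∃ F : Set G, F.Finite ∧ F ⊆ A.posCone ∧
      ∀ B : LeftOrdering G, F ⊆ B.posCone → B ∈ V by
    obtain ⟨F, h₁, h₂, h₃⟩ := h
    exact ⟨F, h₁, h₂, fun B hB => hVU (h₃ B hB)⟩
  clear hVU hU
  induction hV with
  | basic s hs =>
    obtain ⟨f, g, rfl⟩ := hs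
    refine ⟨{f⁻¹ * g}, Set.finite_singleton _,
      Set.singleton_subset_iff.2 (lt_iff_inv_mul_mem_posCone.1 hAV), fun B hB => ?_⟩
    exact lt_iff_inv_mul_mem_posCone.2 (Set.singleton_subset_iff.1 hB)
  | univ => exact ⟨∅, Set.finite_empty, Set.empty_subset _, fun _ _ => trivial⟩
  | inter s t _ _ hs ht =>
    obtain ⟨F, h₁, h₂, h₃⟩ := hs hAV.1
    obtain ⟨F', h₁', h₂', h₃'⟩ := ht hAV.2
    exact ⟨F ∪ F', h₁.union h₁', Set.union_subset h₂ h₂', fun B hB =>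
      ⟨h₃ B (Set.subset_union_left.trans hB), h₃' B (Set.subset_union_right.trans hB)⟩⟩
  | sUnion S _ ih =>
    obtain ⟨s, hs, hAs⟩ := hAV
    obtain ⟨F, h₁, h₂, h₃⟩ := ih s hs hAs
    exact ⟨F, h₁, h₂, fun B hB => ⟨s, hs, h₃ B hB⟩⟩

instance : T1Space (LeftOrdering G) := by
  refine t1Space_iff_exists_open.2 fun A B hne => ?_
  obtain ⟨x, hx, hx'⟩ := Set.not_subset.1 fun h => hne (eq_of_posCone_subset h)
  exact ⟨_, isOpen_setOf_lt 1 x, hx, hx'⟩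

theorem continuous_conj (f : G) : Continuous fun O : LeftOrdering G => O.conj f := by
  refine continuous_generateFrom_iff.2 ?_
  rintro _ ⟨a, b, rfl⟩
  convert! isOpen_setOf_lt (f * a * f⁻¹) (f * b * f⁻¹) using 1
  ext O
  simp [lt, conj]

theorem conj_conj (O : LeftOrdering G) (f g : G) : (O.conj f).conj g = O.conj (f * g) := by
  ext a b
  simp [conj, mul_assoc]

theorem orbit_subset_closure_orbit {A B : LeftOrdering G} (h : A ∈ closure B.orbit) :
    A.orbit ⊆ closure B.orbit := by
  rintro _ ⟨f, rfl⟩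
  refine map_mem_closure (f := fun O : LeftOrdering G => O.conj f) (continuous_conj f) h ?_
  rintro _ ⟨g, rfl⟩
  exact ⟨g * f, (conj_conj B g f).symm⟩

theorem accPt_orbit_trans {A B D : LeftOrdering G} (hAB : AccPt A (𝓟 B.orbit))
    (hBD : AccPt B (𝓟 D.orbit)) : AccPt A (𝓟 D.orbit) := by
  have hsub := orbit_subset_closure_orbit (mem_closure_iff_clusterPt.2 hBD.clusterPt)
  rw [← mem_derivedSet, ← derivedSet_closure]
  exact hAB.mono (principal_mono.2 hsub)

/-- Suppose that `O` is not Conradian and its Conradian soul `C` has finitely many orderings.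
Then the orbit of the extension of each ordering of `C` accumulates at the extension of some,
possibly different, ordering of `C`. -/
theorem exists_accPt_orbit_extend {O : LeftOrdering G} (hO : ¬ O.IsConradian)
    [Finite (LeftOrdering O.conradianSoul)] (P : LeftOrdering O.conradianSoul) :
    ∃ P' : LeftOrdering O.conradianSoul,
      AccPt (O.extend O.conradianSoul O.isConvex_conradianSoul P')
        (𝓟 (O.extend O.conradianSoul O.isConvex_conradianSoul P).orbit) := by
  have hC : O.IsConvex O.conradianSoul := O.isConvex_conradianSoul
  by_contra! hcon
  simp only [accPt_iff_nhds, not_forall, not_exists, not_and, not_not] at hcon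
  choose U hU hU' using hcon
  choose F hFfin hFpos hFU using fun P' => exists_finset_of_mem_nhds (hU P')
  set A := O.extend O.conradianSoul hC P with hA
  have hAQ : A.posOutside O.conradianSoul = O.posOutside O.conradianSoul := posOutside_extend
  have hAC : A.IsConvex O.conradianSoul := hC.of_posOutside_eq hAQ
  -- all the elements of the sets `F P'` outside `O.conradianSoul` are at least `ε` for the ordering `A`
  obtain ⟨ε, hε, hmin⟩ : ∃ ε ∈ O.posOutside O.conradianSoul,
      ∀ x ∈ (⋃ P', F P') ∩ O.posOutside O.conradianSoul, A.le ε x := by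
    have hfin : ((⋃ P', F P') ∩ O.posOutside O.conradianSoul).Finite :=
      (Set.finite_iUnion hFfin).inter_of_left _
    refine Set.Finite.induction_on_subset _ hfin ?_ ?_
    · obtain ⟨ε, hε⟩ := posOutside_conradianSoul_nonempty hO
      exact ⟨ε, hε, by simp⟩
    · rintro a s ha - - ⟨ε, hε, hs⟩
      rcases A.total ε a with h | h
      · refine ⟨ε, hε, ?_⟩
        rintro x (rfl | hx)
        exacts [h, hs x hx]
      · refine ⟨a, ha.2, ?_⟩
        rintro x (rfl | hx)
        exacts [A.refl _, A.trans _ _ _ h (hs x hx)]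
  obtain ⟨p, hp, hpε, hpS⟩ := exists_notMem_normalizer_conradianSoul hε
  have hp1 : p ∈ A.posCone := (hAQ ▸ hp : p ∈ A.posOutside O.conradianSoul).1
  have hple : A.le p ε := by
    rcases hpε with rfl | h
    · exact A.refl _
    · exact (lt_iff_inv_mul_mem_posCone.2 (hAQ ▸ h : p⁻¹ * ε ∈ A.posOutside O.conradianSoul).1).1
  set B := A.conj p⁻¹ with hB
  have hBF : F (B.restrict O.conradianSoul) ⊆ B.posCone := by
    intro x hx
    have hx' := hFpos _ hx
    by_cases hxC : x ∈ O.conradianSoul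
    · exact mem_posCone_restrict.1 (coe_mem_posCone_extend (x := ⟨x, hxC⟩).1 hx')
    · have hxε := hmin x ⟨Set.mem_iUnion.2 ⟨_, hx⟩,
        (mem_posCone_extend_of_notMem hxC).1 hx', hxC⟩
      -- `p ≼ ε ≼ x ≺ x p`
      rw [mem_posCone_conj, inv_inv, mul_assoc, ← lt_iff_inv_mul_mem_posCone]
      have h₁ : A.lt x (x * p) := lt_iff_inv_mul_mem_posCone.2 (by simpa using hp1)
      have h₂ := A.trans _ _ _ hple hxε
      exact ⟨A.trans _ _ _ h₂ h₁.1, fun e => h₁.2 (A.antisymm _ _ h₁.1 (e ▸ h₂))⟩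
  have hBeq := hU' (B.restrict O.conradianSoul) B ⟨hFU _ B hBF, p⁻¹, rfl⟩
  refine hpS (hAQ ▸ hAC.mem_normalizer_posOutside ?_)
  rw [← hB, hBeq, posOutside_extend, hAQ]

end LeftOrdering

theorem mainTheorem8 {G : Type*} [Group G] [Countable G] (O : LeftOrdering G)
    (hO : ¬ O.IsConradian) (hsoul : O.conradianSoul ≠ ⊥)
    (hfin : Finite (LeftOrdering O.conradianSoul)) :
    ∃ P : LeftOrdering O.conradianSoul,
      AccPt (O.extend O.conradianSoul O.isConvex_conradianSoul P)
        (𝓟 (O.extend O.conradianSoul O.isConvex_conradianSoul P).orbit) := by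
  let E := O.extend O.conradianSoul O.isConvex_conradianSoul
  let r : LeftOrdering O.conradianSoul → LeftOrdering O.conradianSoul → Prop :=
    fun P' P => AccPt (E P') (𝓟 (E P).orbit)
  by_contra! hcon
  -- otherwise accumulation would be a strict order on a finite set without minimal elements
  have : IsTrans _ r := ⟨fun _ _ _ => LeftOrdering.accPt_orbit_trans⟩
  have : Std.Irrefl r := ⟨hcon⟩
  obtain ⟨P, -, hP⟩ := (Finite.wellFounded_of_trans_of_irrefl r).has_min Set.univ
    ⟨O.restrict _, trivial⟩
  obtain ⟨P', hP'⟩ := LeftOrdering.exists_accPt_orbit_extend hO P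
  exact hP P' trivial hP'
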